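/- Let $\Omega\subseteq\mathbb R^d$ be open (in particular, $\Omega$ may be any bounded Lipschitz domain). For a positive finite Borel measure $\gamma$ on $\Omega$ and $u\in L^1(\Omega)$ set $$\mathrm{TV}_{\mathrm{pwL}}^{\gamma}(u):=\inf\bigl\{\,|Du-g|(\Omega)\ :\ g \text{ an } \mathbb R^d\text{-valued finite Radon measure on }\Omega,\ |g|\le\gamma\,\bigr\}\in[0,\infty],$$ where $|\cdot|$ denotes the variation measure with respect to the Euclidean norm, and $Du$ is the weak gradient of $u$, i.e. the $\mathbb R^d$-valued measure with $\int_\Omega u\,\mathrm{div}\,\varphi\,dx=-\int_\Omega \varphi\cdot dDu$ for all $\varphi\in C_c^\infty(\Omega;\mathbb R^d)$; if no such measure exists, then $\mathrm{TV}_{\mathrm{pwL}}^{\gamma}(u):=\infty$. Then $\mathrm{TV}_{\mathrm{pwL}}$ is jointly lower semicontinuous in $u$ and $\gamma$. More precisely, let $u_n\to u$ in $L^1(\Omega)$ and let $\gamma_n,\gamma$ be positive finite measures with $\gamma_n\rightharpoonup^*\gamma$ weakly-$*$, i.e. $\int_\Omega\phi\,d\gamma_n\to\int_\Omega\phi\,d\gamma$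 for all $\phi\in C_0(\Omega)$. Then $$\begin{aligned}\mathrm{TV}_{\mathrm{pwL}}^{\gamma}(u)&=\sup_{\varphi}\Bigl\{\int_\Omega u\,\mathrm{div}\,\varphi\,dx-\int_\Omega|\varphi|\,d\gamma\Bigr\}=\sup_{\varphi}\lim_{n\to\infty}\Bigl\{\int_\Omega u_n\,\mathrm{div}\,\varphi\,dx-\int_\Omega|\varphi|\,d\gamma_n\Bigr\}\\&\le\liminf_{n\to\infty}\,\sup_{\varphi}\Bigl\{\int_\Omega u_n\,\mathrm{div}\,\varphi\,dx-\int_\Omega|\varphi|\,d\gamma_n\Bigr\}=\liminf_{n\to\infty}\mathrm{TV}_{\mathrm{pwL}}^{\gamma_n}(u_n),\end{aligned}$$ where the suprema run over all $\varphi\in C_c^\infty(\Omega;\mathbb R^d)$ with $|\varphi|\le 1$ pointwise, the limits exist for every such $\varphi$, and the suprema in the second line equal $\mathrm{TV}_{\mathrm{pwL}}^{\gamma_n}(u_n)$ for every $n$. -/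

import Mathlib

open MeasureTheory Filter Topology TopologicalSpace
open scoped ENNReal ZeroAtInfty Distributions

namespace TVpwL

/-- Lebesgue measure on the open set `Ω ⊆ ℝᵈ`. -/
noncomputable abbrev lebesgue {d : ℕ} (Ω : Opens (EuclideanSpace ℝ (Fin d))) : Measure Ω :=
  Measure.comap Subtype.val volume

/-- The divergence `∑ i, ∂ᵢ φᵢ` of a vector field on `ℝᵈ`. -/
noncomputable def divergence {d : ℕ}
    (φ : EuclideanSpace ℝ (Fin d) → EuclideanSpace ℝ (Fin d)) (x : EuclideanSpace ℝ (Fin d)) : ℝ :=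
  ∑ i : Fin d, (fderiv ℝ φ x (EuclideanSpace.single i 1)) i

/-- The `ℝᵈ`-valued measure `D` on the open set `Ω` is the weak gradient of `u ∈ L¹(Ω)`:
`∫_Ω u div φ dx = - ∫_Ω φ · dD` for every smooth compactly supported vector field `φ` on `Ω`. -/
def IsWeakGradient {d : ℕ} {Ω : Opens (EuclideanSpace ℝ (Fin d))}
    (u : Lp ℝ 1 (lebesgue Ω)) (D : VectorMeasure Ω (EuclideanSpace ℝ (Fin d))) : Prop :=
  ∀ φ : 𝓓(Ω, EuclideanSpace ℝ (Fin d)),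
    ∫ x : Ω, u x * divergence φ x ∂(lebesgue Ω) = - ∫ᵛ x : Ω, φ x ∂[innerSL ℝ; D]

/-- The functional `TV_pwL^γ(u)`, the infimum of the Radon norm `‖Du - g‖` over the `ℝᵈ`-valued
measures `g` on `Ω` whose variation measure satisfies `|g| ≤ γ`. The weak gradient measure `Du` is
unique if it exists; if `Du` is not a (finite) measure, the infimum is over the empty set and the
value is `∞`. -/
noncomputable def tvPwL {d : ℕ} {Ω : Opens (EuclideanSpace ℝ (Fin d))}
    (γ : Measure Ω) (u : Lp ℝ 1 (lebesgue Ω)) : ℝ≥0∞ :=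
  ⨅ (D : VectorMeasure Ω (EuclideanSpace ℝ (Fin d))) (_ : IsWeakGradient u D)
    (g : VectorMeasure Ω (EuclideanSpace ℝ (Fin d))) (_ : g.variation ≤ γ),
    (D - g).variation Set.univ

/-- Smooth compactly supported vector fields `φ` on `Ω` with `|φ| ≤ 1` pointwise, where `|·|` is
the Euclidean norm. -/
abbrev UnitField {d : ℕ} (Ω : Opens (EuclideanSpace ℝ (Fin d))) : Type :=
  {φ : 𝓓(Ω, EuclideanSpace ℝ (Fin d)) // ∀ x, ‖φ x‖ ≤ 1}

/-- The dual functional `∫_Ω u div φ dx - ∫_Ω |φ| dγ`. -/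
noncomputable def dualPairing {d : ℕ} {Ω : Opens (EuclideanSpace ℝ (Fin d))}
    (γ : Measure Ω) (u : Lp ℝ 1 (lebesgue Ω)) (φ : UnitField Ω) : ℝ :=
  (∫ x : Ω, u x * divergence φ.1 x ∂(lebesgue Ω)) - ∫ x : Ω, ‖φ.1 x‖ ∂γ

end TVpwL

namespace TVpwL

/-- **Hahn–Banach sandwich theorem**: if `r ≤ N e` for all `(e, r)` in a convex cone and `N` is
sublinear, then some linear `g ≤ N` satisfies `r ≤ g e` on the cone. -/
theorem exists_linearMap_le_sublinear_of_convexCone {E : Type*} [AddCommGroup E] [Module ℝ E]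
    (N : E → ℝ) (N_hom : ∀ c : ℝ, 0 < c → ∀ x, N (c • x) = c * N x)
    (N_add : ∀ x y, N (x + y) ≤ N x + N y)
    (C : ConvexCone ℝ (E × ℝ)) (hne : (C : Set (E × ℝ)).Nonempty)
    (hC : ∀ p ∈ C, p.2 ≤ N p.1) :
    ∃ g : E →ₗ[ℝ] ℝ, (∀ x, g x ≤ N x) ∧ ∀ p ∈ C, p.2 ≤ g p.1 := by
  have : Nonempty C := hne.to_subtype
  have N_zero : N 0 = 0 := by grind [N_hom 2 (by norm_num) 0, smul_zero]
  set Q : E → ℝ := fun f => ⨅ p : C, (N (f + p.1.1) - p.1.2) with hQ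
  have bdd (f : E) : BddBelow (Set.range fun p : C => N (f + p.1.1) - p.1.2) := by
    refine ⟨-N (-f), ?_⟩
    rintro _ ⟨p, rfl⟩
    have h1 := hC p.1 p.2
    have h2 := N_add (f + p.1.1) (-f)
    rw [add_neg_cancel_comm] at h2
    dsimp only
    linarith
  have Q_le (f : E) (p : E × ℝ) (hp : p ∈ C) : Q f ≤ N (f + p.1) - p.2 := ciInf_le (bdd f) ⟨p, hp⟩
  have Q_smul_le (c : ℝ) (hc : 0 < c) (f : E) : Q (c • f) ≤ c * Q f := by
    rw [hQ, Real.mul_iInf_of_nonneg hc.le]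
    refine le_ciInf fun p => ?_
    refine (Q_le (c • f) _ (C.smul_mem hc p.2)).trans_eq ?_
    rw [Prod.smul_fst, Prod.smul_snd, ← smul_add, N_hom c hc, smul_eq_mul, mul_sub]
  have Q_hom (c : ℝ) (hc : 0 < c) (f : E) : Q (c • f) = c * Q f := by
    refine le_antisymm (Q_smul_le c hc f) ?_
    have := Q_smul_le c⁻¹ (inv_pos.2 hc) (c • f)
    rw [inv_smul_smul₀ hc.ne'] at this
    rwa [← le_inv_mul_iff₀ hc]
  have Q_add (f g : E) : Q (f + g) ≤ Q f + Q g := by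
    refine le_ciInf_add_ciInf fun p q => ?_
    have h1 := Q_le (f + g) _ (C.add_mem p.2 q.2)
    have h2 := N_add (f + p.1.1) (g + q.1.1)
    rw [add_add_add_comm] at h2
    simp only [Prod.fst_add, Prod.snd_add] at h1
    linarith
  have Q_le_N (f : E) : Q f ≤ N f := by
    have (ε : ℝ) (hε : 0 < ε) : Q f ≤ N f + ε := by
      obtain ⟨p, hp⟩ := hne
      set M : ℝ := |N p.1 - p.2| + 1
      have hM : 0 < M := by positivity
      have h1 := Q_le f _ (C.smul_mem (div_pos hε hM) hp)
      have h2 := N_add f ((ε / M) • p.1)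
      rw [N_hom _ (div_pos hε hM)] at h2
      simp only [Prod.smul_fst, Prod.smul_snd, smul_eq_mul] at h1
      have h3 : ε / M * (N p.1 - p.2) ≤ ε / M * M := by
        gcongr
        exact (le_abs_self _).trans (by simp [M])
      rw [div_mul_cancel₀ _ hM.ne'] at h3
      linarith
    exact le_of_forall_pos_le_add this
  obtain ⟨g, -, hg⟩ := exists_extension_of_le_sublinear (⟨⊥, 0⟩ : E →ₗ.[ℝ] ℝ) Q Q_hom Q_add (by
    rintro ⟨x, hx⟩
    obtain rfl : x = 0 := by simpa using hx
    have := Q_hom 2 (by norm_num) 0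
    rw [smul_zero] at this
    have h0 : Q 0 = 0 := by linarith
    simp [h0])
  refine ⟨g, fun x => (hg x).trans (Q_le_N x), fun p hp => ?_⟩
  have h1 := (hg (-p.1)).trans (Q_le (-p.1) p hp)
  rw [neg_add_cancel, N_zero, map_neg] at h1
  linarith

open CompactlySupported in
/-- A convex cone of pairs `(e, r)` with `r ≤ S * sup e⁺` is dominated by integration against a
positive measure of mass at most `S`. -/
theorem exists_measure_of_convexCone {X : Type*} [TopologicalSpace X] [T2Space X]
    [LocallyCompactSpace X] [MeasurableSpace X] [BorelSpace X]
    (C : ConvexCone ℝ (C_c(X, ℝ) × ℝ)) (hne : (C : Set (C_c(X, ℝ) × ℝ)).Nonempty)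
    (S : ℝ) (hS : 0 ≤ S)
    (hC : ∀ p ∈ C, ∀ M : ℝ, 0 < M → (∀ x, p.1 x ≤ M) → p.2 ≤ S * M) :
    ∃ μ : Measure X, μ Set.univ ≤ ENNReal.ofReal S ∧ ∀ p ∈ C, p.2 ≤ ∫ x, p.1 x ∂μ := by
  set sp : C_c(X, ℝ) → ℝ := fun f => ⨆ x, max (f x) 0 with hsp
  have bdd (f : C_c(X, ℝ)) : BddAbove (Set.range fun x => max (f x) 0) := by
    obtain ⟨c, hc⟩ := f.hasCompactSupport.exists_bound_of_continuous f.continuous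
    refine ⟨max c 0, ?_⟩
    rintro _ ⟨x, rfl⟩
    exact max_le_max_right _ ((le_abs_self _).trans (hc x))
  have le_sp (f : C_c(X, ℝ)) (x : X) : max (f x) 0 ≤ sp f := le_ciSup (bdd f) x
  have sp_nonneg (f : C_c(X, ℝ)) : 0 ≤ sp f := Real.iSup_nonneg fun x => le_max_right _ _
  have sp_le (f : C_c(X, ℝ)) (M : ℝ) (hM : 0 ≤ M) (h : ∀ x, f x ≤ M) : sp f ≤ M :=
    Real.iSup_le (fun x => max_le (h x) hM) hM
  obtain ⟨g, hg, hgC⟩ := exists_linearMap_le_sublinear_of_convexCone (fun f => S * sp f)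
    (fun c hc f => by
      rw [mul_left_comm, hsp]
      dsimp only
      rw [Real.mul_iSup_of_nonneg hc.le]
      simp [mul_max_of_nonneg _ _ hc.le])
    (fun f₁ f₂ => by
      rw [← mul_add]
      refine mul_le_mul_of_nonneg_left (sp_le _ _ (add_nonneg (sp_nonneg _) (sp_nonneg _))
        fun x => ?_) hS
      exact add_le_add ((le_max_left _ _).trans (le_sp f₁ x)) ((le_max_left _ _).trans (le_sp f₂ x)))
    C hne (fun p hp => by
      refine le_of_forall_pos_le_add fun ε hε => ?_
      have hδ : 0 < ε / (S + 1) := by positivity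
      refine (hC p hp (sp p.1 + ε / (S + 1)) (add_pos_of_nonneg_of_pos (sp_nonneg _) hδ)
        fun x => ?_).trans ?_
      · exact ((le_max_left _ _).trans (le_sp p.1 x)).trans (by linarith)
      · rw [mul_add]
        gcongr
        rw [mul_div_assoc', div_le_iff₀ (by positivity)]
        nlinarith)
  have g_nonneg (f : C_c(X, ℝ)) (hf : 0 ≤ f) : 0 ≤ g f := by
    have h1 := hg (-f)
    have h2 : sp (-f) ≤ 0 := sp_le _ _ le_rfl fun x => by
      have : 0 ≤ f x := hf x
      simpa using this
    have h3 : S * sp (-f) ≤ 0 := mul_nonpos_of_nonneg_of_nonpos hS h2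
    rw [map_neg] at h1
    linarith
  set Λ : C_c(X, ℝ) →ₚ[ℝ] ℝ := PositiveLinearMap.mk₀ g g_nonneg with hΛ
  refine ⟨RealRMK.rieszMeasure Λ, ?_, fun p hp => ?_⟩
  · rw [isOpen_univ.measure_eq_iSup_isCompact]
    refine iSup₂_le fun K _ => iSup_le fun hK => ?_
    obtain ⟨f, hf1, hf2, hf3⟩ := exists_continuousMap_one_of_isCompact_subset_isOpen hK
      isOpen_univ (Set.subset_univ K)
    let F : C_c(X, ℝ) := ⟨f, hasCompactSupport_def.mpr hf2⟩
    refine (RealRMK.rieszMeasure_le_of_eq_one Λ (f := F) (fun x => (hf3.2 x).1) hK hf1).trans ?_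
    refine ENNReal.ofReal_le_ofReal ((hg F).trans ?_)
    exact mul_le_of_le_one_right hS (sp_le F 1 zero_le_one fun x => (hf3.2 x).2)
  · rw [RealRMK.integral_rieszMeasure]
    exact hgC p hp

/-- A linear functional dominated by the `L¹(ν)`-seminorm, with `ν` finite, is integration against
a density of norm at most `1`. -/
theorem exists_density_of_le_integral_norm {X E V : Type*} [MeasurableSpace X]
    [NormedAddCommGroup E] [InnerProductSpace ℝ E] [CompleteSpace E] [AddCommGroup V] [Module ℝ V]
    (ν : Measure X) [IsFiniteMeasure ν] (T : V →ₗ[ℝ] X → E) (hT : ∀ v, MemLp (T v) 2 ν)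
    (l : V →ₗ[ℝ] ℝ) (hl : ∀ v, l v ≤ ∫ x, ‖T v x‖ ∂ν) :
    ∃ h : X → E, StronglyMeasurable h ∧ (∀ᵐ x ∂ν, ‖h x‖ ≤ 1) ∧
      ∀ v, l v = ∫ x, inner ℝ (T v x) (h x) ∂ν := by
  have int (f : Lp E 2 ν) : Integrable f ν := (Lp.memLp f).integrable one_le_two
  let C : ConvexCone ℝ (Lp E 2 ν × ℝ) :=
    { carrier := {p | ∃ v, p = ((hT v).toLp, l v)}
      smul_mem' := by
        rintro c - _ ⟨v, rfl⟩
        refine ⟨c • v, ?_⟩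
        rw [Prod.smul_mk, ← MemLp.toLp_const_smul, ← map_smul l]
        exact congrArg (·, l (c • v)) (MemLp.toLp_congr _ _ (by simp))
      add_mem' := by
        rintro _ ⟨v, rfl⟩ _ ⟨w, rfl⟩
        refine ⟨v + w, ?_⟩
        rw [Prod.mk_add_mk, ← MemLp.toLp_add, ← map_add l]
        exact congrArg (·, l (v + w)) (MemLp.toLp_congr _ _ (by simp)) }
  obtain ⟨g, hg, hgC⟩ := exists_linearMap_le_sublinear_of_convexCone
    (fun f : Lp E 2 ν => ∫ x, ‖f x‖ ∂ν)
    (fun c hc f => by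
      rw [← integral_const_mul]
      refine integral_congr_ae ?_
      filter_upwards [Lp.coeFn_smul c f] with x hx
      simp [hx, norm_smul, abs_of_pos hc])
    (fun f₁ f₂ => by
      rw [← integral_add (int f₁).norm (int f₂).norm]
      refine integral_mono_ae (int _).norm ((int f₁).norm.add (int f₂).norm) ?_
      filter_upwards [Lp.coeFn_add f₁ f₂] with x hx
      rw [hx]
      exact norm_add_le _ _)
    C ⟨_, 0, rfl⟩ (by
      rintro _ ⟨v, rfl⟩
      refine (hl v).trans_eq (integral_congr_ae ?_)
      filter_upwards [(hT v).coeFn_toLp] with x hx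
      simp [hx])
  have g_toLp (v : V) : g (hT v).toLp = l v := by
    refine le_antisymm ?_ (hgC _ ⟨v, rfl⟩)
    have h1 : l (-v) ≤ g (hT (-v)).toLp := hgC _ ⟨-v, rfl⟩
    have h2 : (hT (-v)).toLp = -(hT v).toLp := by
      rw [← MemLp.toLp_neg]
      exact MemLp.toLp_congr _ _ (by simp)
    rw [h2, map_neg, map_neg] at h1
    linarith
  obtain ⟨c, hc⟩ : ∃ c : ℝ, ∀ f : Lp E 2 ν, ∫ x, ‖f x‖ ∂ν ≤ c * ‖f‖ := by
    refine ⟨(ν Set.univ ^ (1 / (1 : ℝ≥0∞).toReal - 1 / (2 : ℝ≥0∞).toReal)).toReal,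
      fun f => ?_⟩
    rw [integral_norm_eq_lintegral_enorm (Lp.aestronglyMeasurable f), Lp.norm_def,
      ← ENNReal.toReal_mul, ← eLpNorm_one_eq_lintegral_enorm, mul_comm]
    refine ENNReal.toReal_mono ?_ (eLpNorm_le_eLpNorm_mul_rpow_measure_univ one_le_two
      (Lp.aestronglyMeasurable f))
    refine ENNReal.mul_ne_top (Lp.eLpNorm_ne_top f) (ENNReal.rpow_ne_top_of_nonneg ?_ (by simp))
    norm_num
  have g_bound (f : Lp E 2 ν) : ‖g f‖ ≤ c * ‖f‖ := by
    rw [Real.norm_eq_abs, abs_le']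
    refine ⟨(hg f).trans (hc f), ?_⟩
    rw [← map_neg, ← norm_neg f]
    exact (hg (-f)).trans (hc (-f))
  set h : Lp E 2 ν := (InnerProductSpace.toDual ℝ (Lp E 2 ν)).symm (g.mkContinuous c g_bound)
  have g_eq (f : Lp E 2 ν) : g f = ∫ x, inner ℝ (f x) (h x) ∂ν := by
    rw [← L2.inner_def, real_inner_comm, InnerProductSpace.toDual_symm_apply]
    rfl
  have hsm : StronglyMeasurable h := Lp.stronglyMeasurable h
  refine ⟨h, hsm, ?_, fun v => ?_⟩
  · set A : Set X := {x | 1 < ‖h x‖}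
    have hA : MeasurableSet A := measurableSet_lt measurable_const hsm.norm.measurable
    have hmem : MemLp (A.indicator h) 2 ν := (Lp.memLp h).indicator hA
    have h1 : g hmem.toLp ≤ ∫ x, A.indicator (fun x => ‖h x‖) x ∂ν := by
      refine (hg _).trans_eq (integral_congr_ae ?_)
      filter_upwards [hmem.coeFn_toLp] with x hx
      rw [hx, norm_indicator_eq_indicator_norm]
    have h2 : g hmem.toLp = ∫ x, A.indicator (fun x => ‖h x‖ ^ 2) x ∂ν := by
      rw [g_eq]
      refine integral_congr_ae ?_
      filter_upwards [hmem.coeFn_toLp] with x hx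
      by_cases hxA : x ∈ A <;> simp [hx, hxA]
    have i1 : Integrable (A.indicator fun x => ‖h x‖) ν := (int h).norm.indicator hA
    have i2 : Integrable (A.indicator fun x => ‖h x‖ ^ 2) ν :=
      ((memLp_two_iff_integrable_sq_norm hsm.aestronglyMeasurable).1 (Lp.memLp h)).indicator hA
    have nonneg : 0 ≤ fun x => A.indicator (fun x => ‖h x‖ ^ 2) x - A.indicator (‖h ·‖) x := by
      intro x
      by_cases hxA : x ∈ A
      · have : 1 < ‖h x‖ := hxA
        simp only [hxA, Set.indicator_of_mem, Pi.zero_apply]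
        nlinarith
      · simp [hxA]
    have h3 : ∫ x, (A.indicator (fun x => ‖h x‖ ^ 2) x - A.indicator (‖h ·‖) x) ∂ν = 0 := by
      refine le_antisymm ?_ (integral_nonneg nonneg)
      rw [integral_sub i2 i1]
      linarith
    rw [integral_eq_zero_iff_of_nonneg nonneg (i2.sub i1)] at h3
    filter_upwards [h3] with x hx
    by_contra! hxA
    have : x ∈ A := hxA
    simp only [this, Set.indicator_of_mem, Pi.zero_apply] at hx
    nlinarith
  · rw [← g_toLp, g_eq]
    refine integral_congr_ae ?_
    filter_upwards [(hT v).coeFn_toLp] with x hx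
    rw [hx]

theorem variation_withDensityᵥ_le {X E : Type*} [MeasurableSpace X]
    [NormedAddCommGroup E] [NormedSpace ℝ E] [CompleteSpace E]
    {ν : Measure X} {h : X → E} (hh : Integrable h ν) (hb : ∀ᵐ x ∂ν, ‖h x‖ ≤ 1) :
    (ν.withDensityᵥ h).variation ≤ ν := by
  rw [Measure.variation_withDensityᵥ hh]
  conv_rhs => rw [← withDensity_one (μ := ν)]
  refine withDensity_mono ?_
  filter_upwards [hb] with x hx
  simpa [← ofReal_norm] using hx

/-- The integral against a vector measure with bounded density. -/
theorem integral_innerSL_withDensityᵥ {X E : Type*} [MeasurableSpace X]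
    [NormedAddCommGroup E] [InnerProductSpace ℝ E] [CompleteSpace E]
    {ν : Measure X} {h : X → E} (hh : Integrable h ν) (hb : ∀ᵐ x ∂ν, ‖h x‖ ≤ 1)
    {f : X → E} (hf : Integrable f ν) :
    ∫ᵛ x, f x ∂[innerSL ℝ; ν.withDensityᵥ h] = ∫ x, inner ℝ (f x) (h x) ∂ν := by
  have hvar := variation_withDensityᵥ_le hh hb
  have hac : (ν.withDensityᵥ h).variation ≪ ν := Measure.absolutelyContinuous_of_le hvar
  have int_inner {f : X → E} (hf : Integrable f ν) : Integrable (fun x => inner ℝ (f x) (h x)) ν := by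
    refine hf.norm.mono' (hf.aestronglyMeasurable.inner hh.aestronglyMeasurable) ?_
    filter_upwards [hb] with x hx
    exact (norm_inner_le_norm _ _).trans (mul_le_of_le_one_right (norm_nonneg _) hx)
  have : IsFiniteMeasure (ν.withDensityᵥ h).variation := by
    rw [Measure.variation_withDensityᵥ hh]
    exact ⟨by simpa using! hh.2⟩
  refine Integrable.induction
    (fun f => ∫ᵛ x, f x ∂[innerSL ℝ; ν.withDensityᵥ h] = ∫ x, inner ℝ (f x) (h x) ∂ν)
    (fun c s hs hμs => ?_) (fun f g hdisj hf hg ihf ihg => ?_) ?_ (fun f g hfg hf ih => ?_) hf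
  · rw [VectorMeasure.integral_indicator_const c hs, withDensityᵥ_apply hh hs, innerSL_apply_apply,
      ← integral_inner hh.integrableOn, ← MeasureTheory.integral_indicator hs]
    refine integral_congr_ae (Eventually.of_forall fun x => ?_)
    by_cases hx : x ∈ s <;> simp [hx]
  · rw [VectorMeasure.integral_add (hf.mono_measure hvar) (hg.mono_measure hvar), ihf, ihg,
      ← MeasureTheory.integral_add (int_inner hf) (int_inner hg)]
    simp [inner_add_left]
  · refine isClosed_eq (continuous_iff_continuousAt.2 fun f => ?_)
      (continuous_iff_continuousAt.2 fun f => ?_)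
    · have lim := (Lp.tendsto_Lp_iff_tendsto_eLpNorm' _ f).1 (tendsto_id (x := 𝓝 f))
      refine VectorMeasure.tendsto_integral_of_L1' _
        ((Lp.aestronglyMeasurable f).mono_measure hvar)
        (Eventually.of_forall fun g => (L1.integrable_coeFn g).mono_measure hvar) ?_
      exact tendsto_of_tendsto_of_tendsto_of_le_of_le tendsto_const_nhds lim (fun _ => zero_le)
        fun g => eLpNorm_mono_measure _ hvar
    · have lim := (Lp.tendsto_Lp_iff_tendsto_eLpNorm' _ f).1 (tendsto_id (x := 𝓝 f))
      refine tendsto_integral_of_L1' _ (int_inner (L1.integrable_coeFn f)).aestronglyMeasurable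
        (Eventually.of_forall fun g => int_inner (L1.integrable_coeFn g)) ?_
      refine tendsto_of_tendsto_of_tendsto_of_le_of_le tendsto_const_nhds lim (fun _ => zero_le)
        fun g => eLpNorm_mono_ae ?_
      filter_upwards [hb] with x hx
      simp only [Pi.sub_apply, ← inner_sub_left, id]
      exact (norm_inner_le_norm _ _).trans (mul_le_of_le_one_right (norm_nonneg _) hx)
  · rw [← VectorMeasure.integral_congr_ae (hac.ae_eq hfg), ih]
    refine integral_congr_ae ?_
    filter_upwards [hfg] with x hx
    rw [hx]


section TestFields

variable {d : ℕ} {Ω : Opens (EuclideanSpace ℝ (Fin d))}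

theorem continuous_divergence (φ : 𝓓(Ω, EuclideanSpace ℝ (Fin d))) :
    Continuous (divergence φ) := by
  unfold divergence
  have h : Continuous (fderiv ℝ φ) := φ.contDiff.continuous_fderiv (by simp)
  fun_prop

theorem exists_norm_divergence_le (φ : 𝓓(Ω, EuclideanSpace ℝ (Fin d))) :
    ∃ c : ℝ, ∀ x, ‖divergence φ x‖ ≤ c := by
  have hc : HasCompactSupport (divergence φ) :=
    HasCompactSupport.intro (φ.hasCompactSupport.fderiv (𝕜 := ℝ)) fun x hx => by
      simp [divergence, image_eq_zero_of_notMem_tsupport hx]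
  exact hc.exists_bound_of_continuous (continuous_divergence φ)

theorem divergence_add (φ ψ : 𝓓(Ω, EuclideanSpace ℝ (Fin d))) (x : EuclideanSpace ℝ (Fin d)) :
    divergence ⇑(φ + ψ) x = divergence φ x + divergence ψ x := by
  have h (φ : 𝓓(Ω, EuclideanSpace ℝ (Fin d))) : DifferentiableAt ℝ φ x :=
    φ.contDiff.differentiable (by simp) x
  simp [divergence, FunLike.coe_add, fderiv_add (h φ) (h ψ), Finset.sum_add_distrib]

theorem divergence_smul (c : ℝ) (φ : 𝓓(Ω, EuclideanSpace ℝ (Fin d)))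
    (x : EuclideanSpace ℝ (Fin d)) :
    divergence ⇑(c • φ) x = c * divergence φ x := by
  have h : DifferentiableAt ℝ φ x := φ.contDiff.differentiable (by simp) x
  simp [divergence, FunLike.coe_smul, fderiv_const_smul h, Finset.mul_sum]

theorem integrable_mul_divergence (u : Lp ℝ 1 (lebesgue Ω)) (φ : 𝓓(Ω, EuclideanSpace ℝ (Fin d))) :
    Integrable (fun x : Ω => u x * divergence φ x) (lebesgue Ω) := by
  obtain ⟨c, hc⟩ := exists_norm_divergence_le φ
  exact (L1.integrable_coeFn u).mul_bdd
    ((continuous_divergence φ).comp continuous_subtype_val).aestronglyMeasurable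
    (Eventually.of_forall fun x => hc x)

/-- The distributional pairing `φ ↦ ∫_Ω u div φ dx`. -/
noncomputable def divergencePairing (u : Lp ℝ 1 (lebesgue Ω)) :
    𝓓(Ω, EuclideanSpace ℝ (Fin d)) →ₗ[ℝ] ℝ where
  toFun φ := ∫ x : Ω, u x * divergence φ x ∂(lebesgue Ω)
  map_add' φ ψ := by
    rw [← integral_add (integrable_mul_divergence u φ) (integrable_mul_divergence u ψ)]
    simp only [divergence_add, mul_add]
  map_smul' c φ := by
    rw [RingHom.id_apply, smul_eq_mul, ← integral_const_mul]
    simp only [divergence_smul, mul_left_comm]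

theorem tendsto_divergencePairing {us : ℕ → Lp ℝ 1 (lebesgue Ω)} {u : Lp ℝ 1 (lebesgue Ω)}
    (hu : Tendsto us atTop (𝓝 u)) (φ : 𝓓(Ω, EuclideanSpace ℝ (Fin d))) :
    Tendsto (fun n => divergencePairing (us n) φ) atTop (𝓝 (divergencePairing u φ)) := by
  obtain ⟨c, hc⟩ := exists_norm_divergence_le φ
  refine tendsto_integral_of_L1' _ (integrable_mul_divergence u φ).aestronglyMeasurable
    (Eventually.of_forall fun n => integrable_mul_divergence (us n) φ) ?_
  have lim := (Lp.tendsto_Lp_iff_tendsto_eLpNorm' _ u).1 hu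
  have lim' := ENNReal.Tendsto.const_mul (a := ENNReal.ofReal c) lim (Or.inr ENNReal.ofReal_ne_top)
  rw [mul_zero] at lim'
  refine tendsto_of_tendsto_of_tendsto_of_le_of_le tendsto_const_nhds lim' (fun _ => zero_le)
    fun n => eLpNorm_le_mul_eLpNorm_of_ae_le_mul (Eventually.of_forall fun x => ?_) _
  simp only [Pi.sub_apply, ← sub_mul, norm_mul]
  rw [mul_comm]
  gcongr
  exact hc x

theorem hasCompactSupport_restrict (φ : 𝓓(Ω, EuclideanSpace ℝ (Fin d))) :
    HasCompactSupport fun x : Ω => φ x := by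
  refine HasCompactSupport.intro (K := Subtype.val ⁻¹' tsupport φ) ?_
    fun x hx => image_eq_zero_of_notMem_tsupport hx
  exact IsInducing.subtypeVal.isCompact_preimage' φ.hasCompactSupport
    (by simpa using φ.tsupport_subset)

theorem continuous_restrict (φ : 𝓓(Ω, EuclideanSpace ℝ (Fin d))) :
    Continuous fun x : Ω => φ x := φ.continuous.comp continuous_subtype_val

theorem memLp_restrict (φ : 𝓓(Ω, EuclideanSpace ℝ (Fin d))) (ν : Measure Ω) [IsFiniteMeasure ν]
    (p : ℝ≥0∞) : MemLp (fun x : Ω => φ x) p ν :=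
  (continuous_restrict φ).memLp_of_hasCompactSupport (hasCompactSupport_restrict φ)

theorem integrable_restrict (φ : 𝓓(Ω, EuclideanSpace ℝ (Fin d))) (ν : Measure Ω)
    [IsFiniteMeasure ν] : Integrable (fun x : Ω => φ x) ν :=
  memLp_one_iff_integrable.1 (memLp_restrict φ ν 1)

open CompactlySupported in
/-- The pointwise norm of a test field as a compactly supported function on `Ω`. -/
noncomputable def normField (φ : 𝓓(Ω, EuclideanSpace ℝ (Fin d))) : C_c(Ω, ℝ) :=
  ⟨⟨fun x => ‖φ x‖, (continuous_restrict φ).norm⟩, (hasCompactSupport_restrict φ).norm⟩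

theorem tendsto_dualPairing {us : ℕ → Lp ℝ 1 (lebesgue Ω)} {u : Lp ℝ 1 (lebesgue Ω)}
    {γs : ℕ → Measure Ω} {γ : Measure Ω} (hu : Tendsto us atTop (𝓝 u))
    (hγ : ∀ φ : C₀(Ω, ℝ),
      Tendsto (fun n => ∫ x, φ x ∂(γs n)) atTop (𝓝 (∫ x, φ x ∂γ))) (φ : UnitField Ω) :
    Tendsto (fun n => dualPairing (γs n) (us n) φ) atTop (𝓝 (dualPairing γ u φ)) :=
  (tendsto_divergencePairing hu φ.1).sub (hγ (normField φ.1 : C₀(Ω, ℝ)))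

end TestFields

section Duality

variable {d : ℕ} {Ω : Opens (EuclideanSpace ℝ (Fin d))}

theorem norm_integral_innerSL_le (φ : 𝓓(Ω, EuclideanSpace ℝ (Fin d)))
    (μ : VectorMeasure Ω (EuclideanSpace ℝ (Fin d))) :
    ‖∫ᵛ x : Ω, φ x ∂[innerSL ℝ; μ]‖ ≤ ∫ x : Ω, ‖φ x‖ ∂μ.variation :=
  VectorMeasure.norm_integral_le_integral_norm.trans
    (mul_le_of_le_one_left (integral_nonneg fun _ => norm_nonneg _) (norm_innerSL_le _))

theorem ofReal_dualPairing_le_tvPwL (γ : Measure Ω) [IsFiniteMeasure γ]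
    (u : Lp ℝ 1 (lebesgue Ω)) (φ : UnitField Ω) :
    ENNReal.ofReal (dualPairing γ u φ) ≤ tvPwL γ u := by
  refine le_iInf₂ fun D hD => le_iInf₂ fun g hg => ?_
  rcases eq_or_ne ((D - g).variation Set.univ) ∞ with htop | htop
  · simp [htop]
  have : IsFiniteMeasure (D - g).variation := ⟨htop.lt_top⟩
  have : IsFiniteMeasure g.variation := isFiniteMeasure_of_le γ hg
  refine ENNReal.ofReal_le_of_le_toReal ?_
  have hsplit : ∫ᵛ x : Ω, φ.1 x ∂[innerSL ℝ; D] =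
      (∫ᵛ x : Ω, φ.1 x ∂[innerSL ℝ; D - g]) + ∫ᵛ x : Ω, φ.1 x ∂[innerSL ℝ; g] := by
    rw [← VectorMeasure.integral_add_vectorMeasure (integrable_restrict φ.1 _)
      (integrable_restrict φ.1 _), sub_add_cancel]
  have h1 := (abs_le.1 (norm_integral_innerSL_le φ.1 (D - g))).1
  have h2 := (abs_le.1 (norm_integral_innerSL_le φ.1 g)).1
  have h3 : ∫ x : Ω, ‖φ.1 x‖ ∂g.variation ≤ ∫ x : Ω, ‖φ.1 x‖ ∂γ :=
    integral_mono_measure hg (Eventually.of_forall fun _ => norm_nonneg _)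
      (integrable_restrict φ.1 γ).norm
  have h4 : ∫ x : Ω, ‖φ.1 x‖ ∂(D - g).variation ≤ ((D - g).variation Set.univ).toReal := by
    refine (integral_mono (integrable_restrict φ.1 _).norm (integrable_const 1)
      fun x => φ.2 x).trans_eq ?_
    simp [Measure.real]
  rw [dualPairing, hD φ.1, hsplit]
  linarith

open CompactlySupported in
/-- The cone of pairs `(e, r)` for which some test field `φ` has `|φ| ≤ e` and
`r ≤ ∫_Ω u div φ dx - ∫_Ω |φ| dγ`. -/
noncomputable def dualCone (γ : Measure Ω) [IsFiniteMeasure γ] (u : Lp ℝ 1 (lebesgue Ω)) :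
    ConvexCone ℝ (C_c(Ω, ℝ) × ℝ) where
  carrier := {p | ∃ φ : 𝓓(Ω, EuclideanSpace ℝ (Fin d)), (∀ x : Ω, ‖φ x‖ ≤ p.1 x) ∧
    p.2 ≤ divergencePairing u φ - ∫ x : Ω, ‖φ x‖ ∂γ}
  smul_mem' := by
    rintro c hc p ⟨φ, h1, h2⟩
    refine ⟨c • φ, fun x => ?_, ?_⟩
    · simpa [norm_smul, abs_of_pos hc] using mul_le_mul_of_nonneg_left (h1 x) hc.le
    · have := mul_le_mul_of_nonneg_left h2 hc.le
      simpa [norm_smul, abs_of_pos hc, integral_const_mul, mul_sub] using this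
  add_mem' := by
    rintro p ⟨φ, h1, h2⟩ q ⟨ψ, h3, h4⟩
    refine ⟨φ + ψ, fun x => ?_, ?_⟩
    · simpa using (norm_add_le _ _).trans (add_le_add (h1 x) (h3 x))
    · have h5 : ∫ x : Ω, ‖(φ + ψ) x‖ ∂γ ≤ ∫ x : Ω, ‖φ x‖ ∂γ + ∫ x : Ω, ‖ψ x‖ ∂γ := by
        rw [← integral_add (integrable_restrict φ γ).norm (integrable_restrict ψ γ).norm]
        refine integral_mono (integrable_restrict (φ + ψ) γ).norm
          ((integrable_restrict φ γ).norm.add (integrable_restrict ψ γ).norm) fun x => ?_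
        simpa using norm_add_le (φ x) (ψ x)
      rw [map_add, Prod.snd_add]
      linarith

theorem divergencePairing_sub_le {γ : Measure Ω} {u : Lp ℝ 1 (lebesgue Ω)} {S : ℝ}
    (h : ∀ φ : UnitField Ω, dualPairing γ u φ ≤ S) (φ : 𝓓(Ω, EuclideanSpace ℝ (Fin d)))
    {M : ℝ} (hM : 0 < M) (hφ : ∀ x : Ω, ‖φ x‖ ≤ M) :
    divergencePairing u φ - ∫ x : Ω, ‖φ x‖ ∂γ ≤ S * M := by
  have hφ' (x : EuclideanSpace ℝ (Fin d)) : ‖φ x‖ ≤ M := by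
    by_cases hx : x ∈ Ω
    · exact hφ ⟨x, hx⟩
    · rw [image_eq_zero_of_notMem_tsupport fun hx' => hx (φ.tsupport_subset hx'), norm_zero]
      exact hM.le
  have h1 := h ⟨M⁻¹ • φ, fun x => by
    simpa [norm_smul, abs_of_pos hM, inv_mul_le_iff₀ hM] using hφ' x⟩
  have h2 : divergencePairing u (M⁻¹ • φ) - ∫ x : Ω, ‖(M⁻¹ • φ) x‖ ∂γ ≤ S := h1
  rw [map_smul] at h2
  simp only [FunLike.coe_smul, Pi.smul_apply, norm_smul, norm_inv, Real.norm_eq_abs,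
    abs_of_pos hM, integral_const_mul, smul_eq_mul, ← mul_sub] at h2
  rwa [inv_mul_le_iff₀ hM, mul_comm] at h2

theorem tvPwL_le_of_dualPairing_le (γ : Measure Ω) [IsFiniteMeasure γ]
    (u : Lp ℝ 1 (lebesgue Ω)) {S : ℝ} (hS : 0 ≤ S)
    (h : ∀ φ : UnitField Ω, dualPairing γ u φ ≤ S) : tvPwL γ u ≤ ENNReal.ofReal S := by
  have : LocallyCompactSpace Ω := Ω.isOpen.locallyCompactSpace
  obtain ⟨μ, hμS, hμ⟩ := exists_measure_of_convexCone (dualCone γ u)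
    ⟨0, 0, by simp, by simp⟩ S hS (by
      rintro p ⟨φ, h1, h2⟩ M hM hp
      exact h2.trans (divergencePairing_sub_le h φ hM fun x => (h1 x).trans (hp x)))
  have : IsFiniteMeasure μ := ⟨hμS.trans_lt ENNReal.ofReal_lt_top⟩
  have hle (φ : 𝓓(Ω, EuclideanSpace ℝ (Fin d))) :
      divergencePairing u φ ≤ ∫ x : Ω, ‖φ x‖ ∂(μ + γ) := by
    have h1 : divergencePairing u φ - ∫ x : Ω, ‖φ x‖ ∂γ ≤ ∫ x : Ω, ‖φ x‖ ∂μ :=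
      hμ (normField φ, _) ⟨φ, fun _ => le_rfl, le_rfl⟩
    rw [integral_add_measure (integrable_restrict φ μ).norm (integrable_restrict φ γ).norm]
    linarith
  let T : 𝓓(Ω, EuclideanSpace ℝ (Fin d)) →ₗ[ℝ] Ω → EuclideanSpace ℝ (Fin d) :=
    { toFun := fun φ x => φ x
      map_add' := fun _ _ => rfl
      map_smul' := fun _ _ => rfl }
  obtain ⟨k, hk, hk1, hrep⟩ := exists_density_of_le_integral_norm (μ + γ) T
    (fun φ => memLp_restrict φ _ 2) (divergencePairing u) hle
  have hbν : ∀ᵐ x ∂(μ + γ), ‖(-k) x‖ ≤ 1 := by simpa using hk1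
  obtain ⟨hbμ, hbγ⟩ := ae_add_measure_iff.1 hbν
  have hiν : Integrable (-k) (μ + γ) :=
    Integrable.of_bound hk.neg.aestronglyMeasurable 1 hbν
  have hiμ : Integrable (-k) μ := hiν.left_of_add_measure
  have hiγ : Integrable (-k) γ := hiν.right_of_add_measure
  have hD : IsWeakGradient u ((μ + γ).withDensityᵥ (-k)) := fun φ => by
    rw [integral_innerSL_withDensityᵥ hiν hbν (integrable_restrict φ _)]
    simp only [Pi.neg_apply, inner_neg_right, integral_neg, neg_neg]
    exact hrep φ
  have hsub : (μ + γ).withDensityᵥ (-k) - γ.withDensityᵥ (-k) = μ.withDensityᵥ (-k) := by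
    ext1 s hs
    rw [sub_apply, withDensityᵥ_apply hiν hs, withDensityᵥ_apply hiγ hs,
      withDensityᵥ_apply hiμ hs, Measure.restrict_add,
      integral_add_measure hiμ.integrableOn hiγ.integrableOn, add_sub_cancel_right]
  refine (iInf₂_le_of_le _ hD (iInf₂_le (γ.withDensityᵥ (-k))
    (variation_withDensityᵥ_le hiγ hbγ))).trans ?_
  rw [hsub]
  exact (variation_withDensityᵥ_le hiμ hbμ _).trans hμS

theorem tvPwL_eq_iSup_dualPairing (γ : Measure Ω) [IsFiniteMeasure γ]
    (u : Lp ℝ 1 (lebesgue Ω)) :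
    (tvPwL γ u : EReal) = ⨆ φ : UnitField Ω, (dualPairing γ u φ : EReal) := by
  refine le_antisymm ?_ (iSup_le fun φ => ?_)
  · set s : EReal := ⨆ φ : UnitField Ω, (dualPairing γ u φ : EReal)
    have le_s (φ : UnitField Ω) : (dualPairing γ u φ : EReal) ≤ s :=
      le_iSup (fun φ : UnitField Ω => (dualPairing γ u φ : EReal)) φ
    have s_nonneg : 0 ≤ s := by
      have h0 : dualPairing γ u ⟨0, by simp⟩ = 0 := by simp [dualPairing, divergence]
      simpa [h0] using le_s ⟨0, by simp⟩
    rcases eq_or_ne s ⊤ with htop | htop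
    · simp [htop]
    lift s to ℝ using ⟨htop, fun hbot => by simp [hbot] at s_nonneg⟩ with S hS
    have hS0 : 0 ≤ S := by exact_mod_cast s_nonneg
    have h1 := tvPwL_le_of_dualPairing_le γ u hS0 fun φ => by exact_mod_cast le_s φ
    have h2 := EReal.coe_ennreal_le_coe_ennreal_iff.2 h1
    rwa [EReal.coe_ennreal_ofReal, max_eq_left hS0] at h2
  · refine le_trans ?_ (EReal.coe_ennreal_le_coe_ennreal_iff.2 (ofReal_dualPairing_le_tvPwL γ u φ))
    rw [EReal.coe_ennreal_ofReal]
    exact_mod_cast le_max_left _ _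

end Duality

end TVpwL

theorem mainTheorem6 {d : ℕ} (Ω : Opens (EuclideanSpace ℝ (Fin d)))
    (u : Lp ℝ 1 (TVpwL.lebesgue Ω)) (us : ℕ → Lp ℝ 1 (TVpwL.lebesgue Ω))
    (γ : Measure Ω) [IsFiniteMeasure γ]
    (γs : ℕ → Measure Ω) [∀ n, IsFiniteMeasure (γs n)]
    (hu : Tendsto us atTop (𝓝 u))
    (hγ : ∀ φ : C₀(Ω, ℝ),
      Tendsto (fun n => ∫ x, φ x ∂(γs n)) atTop (𝓝 (∫ x, φ x ∂γ))) :
    ((TVpwL.tvPwL γ u : EReal) = ⨆ φ : TVpwL.UnitField Ω, (TVpwL.dualPairing γ u φ : EReal)) ∧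
    (∀ φ : TVpwL.UnitField Ω,
      Tendsto (fun n => TVpwL.dualPairing (γs n) (us n) φ) atTop
        (𝓝 (TVpwL.dualPairing γ u φ))) ∧
    (∀ n, (TVpwL.tvPwL (γs n) (us n) : EReal) =
      ⨆ φ : TVpwL.UnitField Ω, (TVpwL.dualPairing (γs n) (us n) φ : EReal)) ∧
    TVpwL.tvPwL γ u ≤ liminf (fun n => TVpwL.tvPwL (γs n) (us n)) atTop := by
  refine ⟨TVpwL.tvPwL_eq_iSup_dualPairing γ u, TVpwL.tendsto_dualPairing hu hγ,
    fun n => TVpwL.tvPwL_eq_iSup_dualPairing (γs n) (us n), ?_⟩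
  rw [← EReal.coe_ennreal_le_coe_ennreal_iff, TVpwL.tvPwL_eq_iSup_dualPairing γ u]
  refine iSup_le fun φ => ?_
  have h1 : ENNReal.ofReal (TVpwL.dualPairing γ u φ) ≤
      liminf (fun n => TVpwL.tvPwL (γs n) (us n)) atTop := by
    rw [← (ENNReal.tendsto_ofReal (TVpwL.tendsto_dualPairing hu hγ φ)).liminf_eq]
    exact liminf_le_liminf
      (Eventually.of_forall fun n => TVpwL.ofReal_dualPairing_le_tvPwL (γs n) (us n) φ)
  refine le_trans ?_ (EReal.coe_ennreal_le_coe_ennreal_iff.2 h1)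
  rw [EReal.coe_ennreal_ofReal]
  exact_mod_cast le_max_left _ _
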